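/- Let $H_1,H_2$ be complex Hilbert spaces with bounded operators $J_i=J_i^*=J_i^{-1}$ on $H_i$ $(i=1,2)$, so that $(H_i,J_i)$ is a Kreĭn space with indefinite inner product $[x,y]=(J_ix,y)$. Let $A$ be a bounded operator on $H_1$ that is selfadjoint in $(H_1,J_1)$, that is, $A=A^{[*]}:=J_1A^*J_1$, let $B:H_1\to H_2$ be a bounded operator, and put $B^{[*]}:=J_1B^*J_2$. For a bounded selfadjoint operator $H$ on a Hilbert space let $\nu_-(H)\in\{0,1,2,\dots\}\cup\{\infty\}$ be the number of negative squares of the form $(Hx,x)$, i.e. the largest dimension of a subspace on which this form is negative definite. For an operator $C$ selfadjoint in $(H_1,J_1)$ put $\nu_-[C]:=\nu_-(J_1C)$. Let $|A|=(A^*A)^{1/2}$, let $\mathcal H_A=\overline{\operatorname{ran}}\,(J_1A)$, and let $J_A$ be the restriction to $\mathcal H_A$ of $\operatorname{sign}(J_1A)$, where $\operatorname{sign}(t)=1$ for $t\ge 0$ and $\operatorname{sign}(t)=-1$ for $t<0$; then $(\mathcal H_A,J_A)$ is a Kreĭn space. A bounded operator $K:H_2\to\mathcal H_A$ is called $J$-contractive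 if $J_2-K^*J_AK\ge 0$. Assume that $\nu_-[A]<\infty$ and $\nu_-(J_2)<\infty$. If $$\nu_-[A]=\nu_-[A-B^{[*]}B]+\nu_-(J_2),\qquad(1)$$ then $\operatorname{ran}J_1B^{[*]}\subset\operatorname{ran}|A|^{1/2}$, there is exactly one bounded operator $K:H_2\to\mathcal H_A$ with $J_1B^{[*]}=|A|^{1/2}K$, and this $K$ is $J$-contractive. Conversely, if $J_1B^{[*]}=|A|^{1/2}K$ for some $J$-contractive bounded operator $K:H_2\to\mathcal H_A$, then (1) holds. -/

import Mathlib

namespace Krein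

open ContinuousLinearMap
open scoped InnerProductSpace

variable {E F : Type*}
  [NormedAddCommGroup E] [InnerProductSpace ℂ E] [CompleteSpace E]
  [NormedAddCommGroup F] [InnerProductSpace ℂ F] [CompleteSpace F]

/-- A signature operator (fundamental symmetry) `J = J* = J⁻¹`; the pair `(E, J)` is then a Krein
space with the indefinite inner product `[x, y] = (J x, y)`. -/
def IsFundamentalSymmetry (J : E →L[ℂ] E) : Prop :=
  adjoint J = J ∧ J ∘L J = ContinuousLinearMap.id ℂ E

/-- The Krein space adjoint `T^{[*]} = J_E T* J_F` of a bounded operator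
`T : (E, J_E) → (F, J_F)`. -/
noncomputable def kadjoint (JE : E →L[ℂ] E) (JF : F →L[ℂ] F) (T : E →L[ℂ] F) : F →L[ℂ] E :=
  JE ∘L adjoint T ∘L JF

/-- The defining identity `[T x, y]_F = [x, T^{[*]} y]_E` of the Krein space adjoint. -/
theorem inner_kadjoint {JE : E →L[ℂ] E} {JF : F →L[ℂ] F} (hE : IsFundamentalSymmetry JE)
    (hF : IsFundamentalSymmetry JF) (T : E →L[ℂ] F) (x : E) (y : F) :
    ⟪JF (T x), y⟫_ℂ = ⟪JE x, kadjoint JE JF T y⟫_ℂ := by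
  have h1 : JE (JE (adjoint T (JF y))) = adjoint T (JF y) :=
    congrArg (fun S : E →L[ℂ] E => S (adjoint T (JF y))) hE.2
  have h2 : ⟪JE x, JE (adjoint T (JF y))⟫_ℂ = ⟪x, JE (JE (adjoint T (JF y)))⟫_ℂ := by
    rw [← adjoint_inner_right, hE.1]
  have h3 : ⟪JF (T x), y⟫_ℂ = ⟪T x, JF y⟫_ℂ := by
    rw [← adjoint_inner_right, hF.1]
  simp only [kadjoint, coe_comp, Function.comp_apply]
  rw [h2, h1, adjoint_inner_right, h3]

/-- Selfadjointness `A = A^{[*]}` in the Krein space `(E, J)`. -/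
def IsKreinSelfAdjoint (J A : E →L[ℂ] E) : Prop :=
  kadjoint J J A = A

theorem IsKreinSelfAdjoint.isSelfAdjoint {J A : E →L[ℂ] E} (hJ : IsFundamentalSymmetry J)
    (hA : IsKreinSelfAdjoint J A) : IsSelfAdjoint (J ∘L A) := by
  have h : J ∘L A = adjoint A ∘L J := by
    conv_lhs => rw [← hA]
    rw [kadjoint, ← comp_assoc, hJ.2, id_comp]
  rw [isSelfAdjoint_iff']
  rw [adjoint_comp, hJ.1, h]

/-- The number `ν₋(H)` of negative squares of the form `(H x, x)`: the largest dimension (possibly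
infinite) of a subspace on which the form is negative definite. -/
noncomputable def negIndex (H : E →L[ℂ] E) : ℕ∞ :=
  ⨆ (L : Submodule ℂ E) (_ : ∀ x ∈ L, x ≠ 0 → H.reApplyInnerSelf x < 0),
    Cardinal.toENat (Module.rank ℂ L)

/-- The number `ν₋[A] = ν₋(J A)` of negative squares of the form `[A x, x]` on `(E, J)`. -/
noncomputable def kreinNegIndex (J A : E →L[ℂ] E) : ℕ∞ :=
  negIndex (J ∘L A)

/-- The square root `|A|^{1/2}` of the modulus `|A| = (A* A)^{1/2}`. -/
noncomputable def sqrtAbs (A : E →L[ℂ] E) : E →L[ℂ] E :=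
  CFC.sqrt (CFC.abs A)

/-- The spectral subspace `E_H([0, ∞))` of a bounded selfadjoint operator `H`, that is, the
kernel of `|H| - H`. -/
noncomputable def nonnegSubspace (H : E →L[ℂ] E) : Submodule ℂ E :=
  LinearMap.ker (CFC.abs H - H : E →L[ℂ] E).toLinearMap

noncomputable instance (H : E →L[ℂ] E) : CompleteSpace (nonnegSubspace H) :=
  (ContinuousLinearMap.isClosed_ker (CFC.abs H - H)).completeSpace_coe

/-- The unitary signature operator `sign(H)` of a bounded selfadjoint operator `H`, with
`sign(t) = 1` for `t ≥ 0` and `sign(t) = -1` for `t < 0`: it is `1` on `E_H([0, ∞))` and `-1` on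
the orthogonal complement. -/
noncomputable def signOp (H : E →L[ℂ] E) : E →L[ℂ] E :=
  ((nonnegSubspace H).reflection.toContinuousLinearEquiv : E →L[ℂ] E)

theorem isFundamentalSymmetry_signOp (H : E →L[ℂ] E) : IsFundamentalSymmetry (signOp H) := by
  constructor
  · symm
    rw [eq_adjoint_iff]
    intro x y
    have := (nonnegSubspace H).reflection.inner_map_map x ((nonnegSubspace H).reflection y)
    rw [Submodule.reflection_reflection] at this
    exact this
  · ext x
    exact Submodule.reflection_reflection (nonnegSubspace H) x

/-- The polar decomposition `H = sign(H) |H|`. -/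
theorem signOp_comp_abs {H : E →L[ℂ] E} (hH : IsSelfAdjoint H) : signOp H ∘L CFC.abs H = H := by
  have hsq : CFC.abs H * CFC.abs H = H * H := by
    rw [CFC.abs_mul_abs, hH.star_eq]
  have habs : IsSelfAdjoint (CFC.abs H) := (CFC.abs_nonneg H).isSelfAdjoint
  have hcomm : CFC.abs H * H = H * CFC.abs H := by
    have h1 : Commute (star H * H) H := by
      rw [hH.star_eq]; exact (Commute.refl H).mul_left (Commute.refl H)
    have h2 : Commute (CFC.sqrt (star H * H)) H := by
      rw [CFC.sqrt_eq_cfc]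
      exact (h1.cfc_nnreal _)
    exact h2
  ext x
  set p : E := CFC.abs H x + H x with hp
  set q : E := CFC.abs H x - H x with hq
  have hpm : p ∈ nonnegSubspace H := by
    have h0 : (CFC.abs H - H) * (CFC.abs H + H) = 0 := by
      rw [sub_mul, mul_add, mul_add, hsq, hcomm]; abel
    exact congrArg (fun S : E →L[ℂ] E => S x) h0
  have hqm : q ∈ (nonnegSubspace H)ᗮ := by
    rw [Submodule.mem_orthogonal]
    intro u hu
    have hs : adjoint (CFC.abs H - H) = CFC.abs H - H := (habs.sub hH).star_eq
    have h1 : ⟪(CFC.abs H - H) u, x⟫_ℂ = ⟪u, (CFC.abs H - H) x⟫_ℂ := by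
      rw [← adjoint_inner_right, hs]
    have h2 : (CFC.abs H - H) u = 0 := hu
    rw [h2, inner_zero_left] at h1
    exact h1.symm
  have e1 : signOp H p = p := Submodule.reflection_mem_subspace_eq_self hpm
  have e2 : signOp H q = -q :=
    Submodule.reflection_mem_subspace_orthogonalComplement_eq_neg hqm
  have e3 : (2 : ℂ) • (signOp H (CFC.abs H x)) = (2 : ℂ) • H x := by
    rw [← map_smul]
    have : (2 : ℂ) • CFC.abs H x = p + q := by rw [hp, hq, two_smul]; abel
    rw [this, map_add, e1, e2, hp, hq, two_smul]; abel
  exact smul_right_injective E (two_ne_zero (α := ℂ)) e3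

/-- The Hilbert space `cran H`, the closure of the range of `H`. -/
abbrev cran (H : E →L[ℂ] E) : Submodule ℂ E :=
  (LinearMap.range H.toLinearMap).topologicalClosure

theorem signOp_mem_cran {H : E →L[ℂ] E} (hH : IsSelfAdjoint H) {x : E} (hx : x ∈ cran H) :
    signOp H x ∈ cran H := by
  have hJ := isFundamentalSymmetry_signOp H
  have hpol := signOp_comp_abs hH
  have habs : adjoint (CFC.abs H) = CFC.abs H := (CFC.abs_nonneg H).isSelfAdjoint.star_eq
  have hcomm : CFC.abs H ∘L signOp H = H := by
    have h := congrArg adjoint hpol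
    rwa [adjoint_comp, habs, hJ.1, show adjoint H = H from hH.star_eq] at h
  have hHJ : signOp H ∘L H = H ∘L signOp H := by
    calc signOp H ∘L H = signOp H ∘L (CFC.abs H ∘L signOp H) := by rw [hcomm]
      _ = H ∘L signOp H := by rw [← comp_assoc, hpol]
  have hmaps : Set.MapsTo (signOp H) (LinearMap.range H.toLinearMap : Set E)
      (LinearMap.range H.toLinearMap : Set E) := by
    rintro _ ⟨y, rfl⟩
    exact ⟨signOp H y, (congrArg (fun S : E →L[ℂ] E => S y) hHJ).symm⟩
  exact hmaps.closure (signOp H).continuous hx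

/-- The restriction of `sign(H)` to `cran H`. For `H = J A` this is the operator `J_A`, and
`(cran H, J_A)` is the Krein space `H_A`. -/
noncomputable def signOn (H : E →L[ℂ] E) (hH : IsSelfAdjoint H) : cran H →L[ℂ] cran H :=
  ((signOp H) ∘L (cran H).subtypeL).codRestrict (cran H) fun x => signOp_mem_cran hH x.2

theorem isFundamentalSymmetry_signOn (H : E →L[ℂ] E) (hH : IsSelfAdjoint H) :
    IsFundamentalSymmetry (signOn H hH) := by
  have hJ := isFundamentalSymmetry_signOp H
  constructor
  · symm
    rw [eq_adjoint_iff]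
    intro x y
    have h : ⟪signOp H (x : E), (y : E)⟫_ℂ = ⟪(x : E), signOp H (y : E)⟫_ℂ := by
      rw [← adjoint_inner_right, hJ.1]
    exact h
  · ext x
    exact congrArg (fun S : E →L[ℂ] E => S (x : E)) hJ.2

/-- `K : (F, JF) → (E, JE)` is `J`-contractive: `J_F - K* J_E K ≥ 0`. -/
def IsJContractive (JF : F →L[ℂ] F) (JE : E →L[ℂ] E) (K : F →L[ℂ] E) : Prop :=
  (JF - adjoint K ∘L JE ∘L K).IsPositive

end Krein

/-! Put `H = J₁A`, `D = J₂`, `T = J₁B^{[*]} = B*D`, and compute the negative index of the block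
operator with rows `(H, T)` and `(T*, D)` in two ways. The shear `(x, y) ↦ (x, Bx + y)` turns its
form into that of `(H - B*DB) ⊕ D`, so its index is the right side of (1)
(`formIndex_blockForm_eq_add`). Hence (1) says that bordering `H` creates no new negative squares.

Let `S = |H|^{1/2}` and let `P` be the projection onto the negative spectral subspace of `H`. If `T
= SK`, completing the square gives the sign form at `Sx + sign(H)Ky` plus the defect form of `K` at
`y`; contractivity then bounds the index by the rank of `P` (`formIndex_blockForm_eq`).

Conversely, if the indices agree, the block form is nonnegative on all vectors form-orthogonal to
`ran P` (`blockForm_nonneg`). As `ran P` has finite dimension, `S` is invertible there, so such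
vectors can be built by solving for the negative component. A discriminant argument yields `‖T*x‖ ≤
C‖Sx‖`, hence `T = SK`; making the square in the completed form arbitrarily small leaves the defect
form, which is therefore nonnegative. -/

namespace Krein

open ContinuousLinearMap
open scoped InnerProductSpace

/-! ### Negative squares of functions on complex vector spaces -/

section FormIndex

variable {V W X : Type*} [AddCommGroup V] [Module ℂ V] [AddCommGroup W] [Module ℂ W]
  [AddCommGroup X] [Module ℂ X]

/-- The number of negative squares of a function `q` on a complex vector space: the largest
dimension of a subspace on which `q` is negative away from `0`. -/
noncomputable def formIndex (q : V → ℝ) : ℕ∞ :=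
  ⨆ (L : Submodule ℂ V) (_ : ∀ x ∈ L, x ≠ 0 → q x < 0), Cardinal.toENat (Module.rank ℂ L)

theorem toENat_rank_le_formIndex {q : V → ℝ} (h0 : q 0 = 0) (f : W →ₗ[ℂ] V)
    (h : ∀ w, w ≠ 0 → q (f w) < 0) : Cardinal.toENat (Module.rank ℂ W) ≤ formIndex q := by
  have hinj : Function.Injective f := by
    rw [injective_iff_map_eq_zero]
    intro w hw
    by_contra hne
    have := h w hne
    rw [hw, h0] at this
    exact lt_irrefl _ this
  have hr : Cardinal.toENat (Module.rank ℂ W) =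
      Cardinal.toENat (Module.rank ℂ (LinearMap.range f)) := by
    have := congrArg Cardinal.toENat (LinearEquiv.ofInjective f hinj).lift_rank_eq
    simpa only [Cardinal.toENat_lift] using this
  rw [hr]
  refine le_iSup₂_of_le (LinearMap.range f) ?_ le_rfl
  rintro _ ⟨w, rfl⟩ hw
  exact h w fun h => hw (by rw [h, map_zero])

/-- Rank-nullity for `p` on a negative subspace: `r` is injective on the kernel part because `q' 0 =
0`, and the image is negative for `q'`. -/
theorem formIndex_le_add {q : V → ℝ} {q' : X → ℝ} (h0 : q' 0 = 0) (p : V →ₗ[ℂ] W)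
    (r : V →ₗ[ℂ] X) (h : ∀ z, p z = 0 → q z < 0 → q' (r z) < 0) :
    formIndex q ≤ formIndex q' + Cardinal.toENat (Module.rank ℂ W) := by
  refine iSup₂_le fun L hL => ?_
  set p' : L →ₗ[ℂ] W := p ∘ₗ L.subtype
  have hrk := congrArg Cardinal.toENat p'.lift_rank_range_add_rank_ker
  rw [map_add, Cardinal.toENat_lift, Cardinal.toENat_lift, Cardinal.toENat_lift] at hrk
  have hker : Cardinal.toENat (Module.rank ℂ (LinearMap.ker p')) ≤ formIndex q' := by
    refine toENat_rank_le_formIndex h0 (r ∘ₗ L.subtype ∘ₗ (LinearMap.ker p').subtype)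
      fun w hw => h _ w.2 (hL _ w.1.2 fun h => hw ?_)
    exact Subtype.ext (Subtype.ext h)
  have hrange := Cardinal.toENat.monotone' (Submodule.rank_le (LinearMap.range p'))
  rw [← hrk, add_comm]
  exact add_le_add hker hrange

theorem formIndex_le_rank {q : V → ℝ} (p : V →ₗ[ℂ] W) (h : ∀ z, p z = 0 → 0 ≤ q z) :
    formIndex q ≤ Cardinal.toENat (Module.rank ℂ W) := by
  have h1 : formIndex q ≤ formIndex (fun _ : PUnit => (0 : ℝ)) + _ :=
    formIndex_le_add rfl p (0 : V →ₗ[ℂ] PUnit) fun z hz hq => absurd hq (h z hz).not_gt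
  have h2 : formIndex (fun _ : PUnit => (0 : ℝ)) = 0 := by
    refine le_antisymm (iSup₂_le fun L _ => ?_) bot_le
    rw [rank_subsingleton']
    simp
  rwa [h2, zero_add] at h1

/-- Otherwise `z`, being `q`-orthogonal to the range of `f`, would extend this negative subspace of
maximal finite dimension by one dimension. -/
theorem nonneg_of_formIndex_le {q : V → ℝ} (h0 : q 0 = 0) (f : W →ₗ[ℂ] V)
    (hf : ∀ w, w ≠ 0 → q (f w) < 0) (hle : formIndex q ≤ Cardinal.toENat (Module.rank ℂ W))
    (hfin : Cardinal.toENat (Module.rank ℂ W) < ⊤) {z : V}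
    (hz : ∀ w, ∀ c : ℂ, q (f w + c • z) = q (f w) + ‖c‖ ^ 2 * q z) : 0 ≤ q z := by
  by_contra! hneg
  have h1 : Cardinal.toENat (Module.rank ℂ (W × ℂ)) ≤ formIndex q := by
    refine toENat_rank_le_formIndex h0 (f.coprod (LinearMap.toSpanSingleton ℂ V z)) fun w hw => ?_
    obtain ⟨l, c⟩ := w
    have h2 : f.coprod (LinearMap.toSpanSingleton ℂ V z) (l, c) = f l + c • z := by simp
    rw [h2, hz l c]
    by_cases hc : c = 0
    · subst hc
      have hl0 : l ≠ 0 := by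
        rintro rfl
        exact hw rfl
      simpa using hf l hl0
    · have h3 : ‖c‖ ^ 2 * q z < 0 := mul_neg_of_pos_of_neg (by positivity) hneg
      have h4 : q (f l) ≤ 0 := by
        by_cases hl0 : l = 0
        · rw [hl0, map_zero, h0]
        · exact (hf l hl0).le
      linarith
  have h2 := h1.trans hle
  rw [rank_prod, map_add, Cardinal.toENat_lift, Cardinal.toENat_lift, Module.rank_self,
    map_one] at h2
  exact absurd h2 (not_le.2 (ENat.lt_add_one_iff hfin.ne |>.2 le_rfl))

end FormIndex
end Krein

namespace Krein

open ContinuousLinearMap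
open scoped InnerProductSpace

/-! ### The negative spectral subspace and the square root of the modulus -/

section Spectral

variable {E : Type*} [NormedAddCommGroup E] [InnerProductSpace ℂ E] [CompleteSpace E]

/-- The orthogonal projection onto the spectral subspace `E_H((-∞, 0))`. -/
noncomputable abbrev negProj (H : E →L[ℂ] E) : E →L[ℂ] E := (nonnegSubspace H)ᗮ.starProjection

theorem adjoint_sqrtAbs (H : E →L[ℂ] E) : adjoint (sqrtAbs H) = sqrtAbs H :=
  (CFC.sqrt_nonneg (CFC.abs H)).isSelfAdjoint.star_eq

theorem sqrtAbs_inner (H : E →L[ℂ] E) (x y : E) : ⟪sqrtAbs H x, y⟫_ℂ = ⟪x, sqrtAbs H y⟫_ℂ := by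
  rw [← adjoint_inner_right, adjoint_sqrtAbs]

theorem sqrtAbs_sqrtAbs (H : E →L[ℂ] E) (x : E) : sqrtAbs H (sqrtAbs H x) = CFC.abs H x :=
  congrArg (fun S : E →L[ℂ] E => S x) (CFC.sqrt_mul_sqrt_self (CFC.abs H) (CFC.abs_nonneg H))

theorem signOp_sqrtAbs_sqrtAbs {H : E →L[ℂ] E} (hH : IsSelfAdjoint H) (x : E) :
    signOp H (sqrtAbs H (sqrtAbs H x)) = H x := by
  rw [sqrtAbs_sqrtAbs]
  exact congrArg (fun S : E →L[ℂ] E => S x) (signOp_comp_abs hH)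

theorem commute_sqrtAbs {H : E →L[ℂ] E} (hH : IsSelfAdjoint H) : Commute (sqrtAbs H) H := by
  have h1 : Commute (star H * H) H := by
    rw [hH.star_eq]; exact (Commute.refl H).mul_left (Commute.refl H)
  have h2 : Commute (CFC.abs H) H := by
    rw [CFC.abs, CFC.sqrt_eq_cfc]
    exact h1.cfc_nnreal _
  rw [sqrtAbs, CFC.sqrt_eq_cfc]
  exact h2.cfc_nnreal _

theorem sqrtAbs_mem_nonnegSubspace {H : E →L[ℂ] E} (hH : IsSelfAdjoint H) {x : E}
    (hx : x ∈ nonnegSubspace H) : sqrtAbs H x ∈ nonnegSubspace H := by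
  have h1 : Commute (sqrtAbs H) (CFC.abs H - H) := by
    refine Commute.sub_right ?_ (commute_sqrtAbs hH)
    rw [← CFC.sqrt_mul_sqrt_self (CFC.abs H) (CFC.abs_nonneg H)]
    exact (Commute.refl _).mul_right (Commute.refl _)
  have h2 := congrArg (fun S : E →L[ℂ] E => S x) h1.eq
  have h3 : (CFC.abs H - H) x = 0 := hx
  have h4 : sqrtAbs H ((CFC.abs H - H) x) = (CFC.abs H - H) (sqrtAbs H x) := h2
  rw [h3, map_zero] at h4
  exact h4.symm

theorem sqrtAbs_mem_orthogonal {H : E →L[ℂ] E} (hH : IsSelfAdjoint H) {x : E}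
    (hx : x ∈ (nonnegSubspace H)ᗮ) : sqrtAbs H x ∈ (nonnegSubspace H)ᗮ := by
  rw [Submodule.mem_orthogonal] at hx ⊢
  intro u hu
  rw [← sqrtAbs_inner]
  exact hx _ (sqrtAbs_mem_nonnegSubspace hH hu)

theorem sub_negProj_mem (H : E →L[ℂ] E) (x : E) : x - negProj H x ∈ nonnegSubspace H := by
  rw [negProj, Submodule.starProjection_orthogonal']
  simp

theorem negProj_sqrtAbs {H : E →L[ℂ] E} (hH : IsSelfAdjoint H) (x : E) :
    negProj H (sqrtAbs H x) = sqrtAbs H (negProj H x) := by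
  refine Submodule.eq_starProjection_of_mem_of_inner_eq_zero
    (sqrtAbs_mem_orthogonal hH (Submodule.starProjection_apply_mem _ x)) fun w hw => ?_
  rw [← map_sub]
  exact Submodule.inner_right_of_mem_orthogonal
    (sqrtAbs_mem_nonnegSubspace hH (sub_negProj_mem H x)) hw

theorem signOp_apply (H : E →L[ℂ] E) (x : E) : signOp H x = x - 2 • negProj H x := by
  have h : signOp H x = (nonnegSubspace H).reflection x := rfl
  rw [h, Submodule.reflection_apply, negProj, Submodule.starProjection_orthogonal']
  simp only [_root_.sub_apply, one_apply_eq_self, smul_sub, two_smul]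
  abel

theorem signOp_sqrtAbs {H : E →L[ℂ] E} (hH : IsSelfAdjoint H) (x : E) :
    signOp H (sqrtAbs H x) = sqrtAbs H (signOp H x) := by
  rw [signOp_apply, signOp_apply, negProj_sqrtAbs hH, map_sub, map_nsmul]

theorem re_inner_signOp (H : E →L[ℂ] E) (x : E) :
    RCLike.re ⟪signOp H x, x⟫_ℂ = ‖x‖ ^ 2 - 2 * ‖negProj H x‖ ^ 2 := by
  have h : ⟪negProj H x, x⟫_ℂ = ⟪negProj H x, negProj H x⟫_ℂ := by
    have h' : negProj H (negProj H x) = negProj H x :=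
      Submodule.starProjection_eq_self_iff.2 (Submodule.starProjection_apply_mem _ x)
    rw [← Submodule.inner_starProjection_left_eq_right, h']
  rw [signOp_apply, inner_sub_left, two_smul, inner_add_left, h, map_sub, map_add,
    inner_self_eq_norm_sq, inner_self_eq_norm_sq]
  ring

theorem inner_apply_eq_signOp {H : E →L[ℂ] E} (hH : IsSelfAdjoint H) (x y : E) :
    ⟪H x, y⟫_ℂ = ⟪signOp H (sqrtAbs H x), sqrtAbs H y⟫_ℂ := by
  rw [← signOp_sqrtAbs_sqrtAbs hH, signOp_sqrtAbs hH, sqrtAbs_inner]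

theorem apply_eq_zero_of_sqrtAbs {H : E →L[ℂ] E} (hH : IsSelfAdjoint H) {x : E}
    (hx : sqrtAbs H x = 0) : H x = 0 := by
  rw [← signOp_sqrtAbs_sqrtAbs hH, hx, map_zero, map_zero]

theorem sqrtAbs_eq_zero_of_apply {H : E →L[ℂ] E} (hH : IsSelfAdjoint H) {x : E}
    (hx : H x = 0) : sqrtAbs H x = 0 := by
  have h1 : signOp H (H x) = CFC.abs H x := by
    have h2 := congrArg (fun S : E →L[ℂ] E => S (CFC.abs H x)) (isFundamentalSymmetry_signOp H).2
    have h3 : signOp H (CFC.abs H x) = H x :=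
      congrArg (fun S : E →L[ℂ] E => S x) (signOp_comp_abs hH)
    rw [← h3]
    exact h2
  rw [hx, map_zero, ← sqrtAbs_sqrtAbs] at h1
  rw [← inner_self_eq_zero (𝕜 := ℂ), sqrtAbs_inner, ← h1, inner_zero_right]

/-- Since `sign(0) = 1`, the kernel of `H` lies in `nonnegSubspace H`, so its complement carries a
strictly negative form. -/
theorem eq_zero_of_mem_orthogonal {H : E →L[ℂ] E} (hH : IsSelfAdjoint H) {x : E}
    (hx : x ∈ (nonnegSubspace H)ᗮ) (h : sqrtAbs H x = 0) : x = 0 := by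
  have h1 : x ∈ nonnegSubspace H := by
    change (CFC.abs H - H) x = 0
    rw [_root_.sub_apply, apply_eq_zero_of_sqrtAbs hH h, ← sqrtAbs_sqrtAbs, h, map_zero,
      sub_zero]
  exact inner_self_eq_zero.1 (Submodule.inner_right_of_mem_orthogonal (𝕜 := ℂ) h1 hx)

theorem negProj_eq_self {H : E →L[ℂ] E} {x : E} (hx : x ∈ (nonnegSubspace H)ᗮ) :
    negProj H x = x :=
  Submodule.starProjection_eq_self_iff.2 hx

theorem reApplyInnerSelf_eq {H : E →L[ℂ] E} (hH : IsSelfAdjoint H) (x : E) :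
    H.reApplyInnerSelf x = ‖sqrtAbs H x‖ ^ 2 - 2 * ‖negProj H (sqrtAbs H x)‖ ^ 2 := by
  rw [reApplyInnerSelf_apply, inner_apply_eq_signOp hH, re_inner_signOp]

theorem reApplyInnerSelf_neg {H : E →L[ℂ] E} (hH : IsSelfAdjoint H) {x : E}
    (hx : x ∈ (nonnegSubspace H)ᗮ) (h : x ≠ 0) : H.reApplyInnerSelf x < 0 := by
  rw [reApplyInnerSelf_eq hH, negProj_eq_self (sqrtAbs_mem_orthogonal hH hx)]
  have : 0 < ‖sqrtAbs H x‖ := norm_pos_iff.2 fun h0 => h (eq_zero_of_mem_orthogonal hH hx h0)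
  nlinarith

theorem reApplyInnerSelf_nonneg {H : E →L[ℂ] E} (hH : IsSelfAdjoint H) {x : E}
    (hx : negProj H x = 0) : 0 ≤ H.reApplyInnerSelf x := by
  rw [reApplyInnerSelf_eq hH, negProj_sqrtAbs hH, hx]
  simp

theorem negIndex_eq_rank {H : E →L[ℂ] E} (hH : IsSelfAdjoint H) :
    negIndex H = Cardinal.toENat (Module.rank ℂ (nonnegSubspace H)ᗮ) := by
  apply le_antisymm
  · refine formIndex_le_rank (q := H.reApplyInnerSelf)
      ((nonnegSubspace H)ᗮ.orthogonalProjectionOnto).toLinearMap fun z hz => ?_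
    exact reApplyInnerSelf_nonneg hH (congrArg Subtype.val hz)
  · refine le_iSup₂_of_le (nonnegSubspace H)ᗮ ?_ le_rfl
    exact fun x hx h => reApplyInnerSelf_neg hH hx h

theorem range_sqrtAbs_le_cran {H : E →L[ℂ] E} (hH : IsSelfAdjoint H) (x : E) :
    sqrtAbs H x ∈ cran H := by
  have h := orthogonal_ker H
  rw [show adjoint H = H from hH.star_eq] at h
  rw [cran, ← h, Submodule.mem_orthogonal]
  intro u hu
  rw [← sqrtAbs_inner, sqrtAbs_eq_zero_of_apply hH hu, inner_zero_left]

theorem eq_zero_of_mem_cran {H : E →L[ℂ] E} (hH : IsSelfAdjoint H) {x : E} (hx : x ∈ cran H)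
    (h : sqrtAbs H x = 0) : x = 0 := by
  have h1 := orthogonal_ker H
  rw [show adjoint H = H from hH.star_eq] at h1
  rw [cran, ← h1] at hx
  exact inner_self_eq_zero.1 (Submodule.inner_right_of_mem_orthogonal (𝕜 := ℂ)
    (show x ∈ LinearMap.ker H.toLinearMap from apply_eq_zero_of_sqrtAbs hH h) hx)

theorem cran_le_closure_range_sqrtAbs {H : E →L[ℂ] E} (hH : IsSelfAdjoint H) {x : E}
    (hx : x ∈ cran H) : x ∈ closure (Set.range (sqrtAbs H)) := by
  refine closure_mono ?_ hx
  rintro _ ⟨y, rfl⟩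
  -- `H = S sign(H) S = S (S sign(H))` with `S = |H|^{1/2}`.
  exact ⟨sqrtAbs H (signOp H y), by
    rw [← signOp_sqrtAbs hH, ← signOp_sqrtAbs hH, signOp_sqrtAbs_sqrtAbs hH]; rfl⟩

/-- `|H|^{1/2}` as an operator into the closure of the range of `H`. -/
noncomputable def sqrtAbsToCran (H : E →L[ℂ] E) (hH : IsSelfAdjoint H) : E →L[ℂ] cran H :=
  (sqrtAbs H).codRestrict (cran H) (range_sqrtAbs_le_cran hH)

theorem denseRange_sqrtAbsToCran {H : E →L[ℂ] E} (hH : IsSelfAdjoint H) :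
    DenseRange (sqrtAbsToCran H hH) := by
  intro x
  rw [Topology.IsInducing.subtypeVal.closure_eq_preimage_closure_image, Set.mem_preimage,
    ← Set.range_comp]
  exact cran_le_closure_range_sqrtAbs hH x.2

end Spectral
end Krein

namespace Krein

open ContinuousLinearMap
open scoped InnerProductSpace

/-! ### Block operators: nonnegativity, factorization and Schur complements -/

section Block

variable {E F : Type*} [NormedAddCommGroup E] [InnerProductSpace ℂ E]
  [NormedAddCommGroup F] [InnerProductSpace ℂ F]

/-- The quadratic form of the selfadjoint block operator with rows `(H, T)` and `(T*, D)`. -/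
noncomputable def blockForm (H : E →L[ℂ] E) (T : F →L[ℂ] E) (D : F →L[ℂ] F) (z : E × F) : ℝ :=
  H.reApplyInnerSelf z.1 + 2 * RCLike.re ⟪T z.2, z.1⟫_ℂ + D.reApplyInnerSelf z.2

theorem blockForm_zero (H : E →L[ℂ] E) (T : F →L[ℂ] E) (D : F →L[ℂ] F) :
    blockForm H T D 0 = 0 := by
  simp [blockForm, reApplyInnerSelf_apply]

theorem blockForm_inl (H : E →L[ℂ] E) (T : F →L[ℂ] E) (D : F →L[ℂ] F) (x : E) :
    blockForm H T D (x, 0) = H.reApplyInnerSelf x := by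
  simp [blockForm, reApplyInnerSelf_apply]

variable [CompleteSpace E]

theorem factorization_unique {H : E →L[ℂ] E} (hH : IsSelfAdjoint H) {K K' : F →L[ℂ] cran H}
    (h : sqrtAbs H ∘L (cran H).subtypeL ∘L K = sqrtAbs H ∘L (cran H).subtypeL ∘L K') :
    K = K' := by
  ext y
  have h1 : sqrtAbs H (K y : E) = sqrtAbs H (K' y : E) :=
    congrArg (fun S : F →L[ℂ] E => S y) h
  refine sub_eq_zero.1 (eq_zero_of_mem_cran hH ((cran H).sub_mem (K y).2 (K' y).2) ?_)
  rw [map_sub, h1, sub_self]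

theorem negIndex_le_formIndex_blockForm {H : E →L[ℂ] E} (hH : IsSelfAdjoint H)
    (T : F →L[ℂ] E) (D : F →L[ℂ] F) : negIndex H ≤ formIndex (blockForm H T D) := by
  rw [negIndex_eq_rank hH]
  refine toENat_rank_le_formIndex (blockForm_zero H T D)
    (LinearMap.inl ℂ E F ∘ₗ (nonnegSubspace H)ᗮ.subtype) fun w hw => ?_
  have h : w.1 ≠ 0 := fun h => hw (Subtype.ext h)
  exact (blockForm_inl H T D w.1).trans_lt (reApplyInnerSelf_neg hH w.2 h)

/-- The condition on `Hx + Ty` says that `(x, y)` is orthogonal, for the block form, to the negative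
subspace of `H`, which is already of maximal dimension. -/
theorem blockForm_nonneg {H : E →L[ℂ] E} (hH : IsSelfAdjoint H) (hfin : negIndex H < ⊤)
    {T : F →L[ℂ] E} {D : F →L[ℂ] F} (hle : formIndex (blockForm H T D) ≤ negIndex H)
    {x : E} {y : F} (hxy : negProj H (H x + T y) = 0) : 0 ≤ blockForm H T D (x, y) := by
  rw [negIndex_eq_rank hH] at hle hfin
  refine nonneg_of_formIndex_le (blockForm_zero H T D)
    (LinearMap.inl ℂ E F ∘ₗ (nonnegSubspace H)ᗮ.subtype) (fun w hw => ?_) hle hfin fun w c => ?_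
  · have h : w.1 ≠ 0 := fun h => hw (Subtype.ext h)
    exact (blockForm_inl H T D w.1).trans_lt (reApplyInnerSelf_neg hH w.2 h)
  · have e1 : (LinearMap.inl ℂ E F ∘ₗ (nonnegSubspace H)ᗮ.subtype) w + c • (x, y) =
        ((w : E) + c • x, c • y) := by simp
    have e2 : (LinearMap.inl ℂ E F ∘ₗ (nonnegSubspace H)ᗮ.subtype) w = ((w : E), 0) := rfl
    rw [e1, e2, blockForm_inl]
    have hs : ∀ u v : E, ⟪H u, v⟫_ℂ = ⟪u, H v⟫_ℂ := fun u v => by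
      rw [← adjoint_inner_right, show adjoint H = H from hH.star_eq]
    have h0 : ⟪H x + T y, (w : E)⟫_ℂ = 0 := by
      have h : ⟪negProj H (H x + T y), (w : E)⟫_ℂ = 0 := by rw [hxy, inner_zero_left]
      rwa [Submodule.inner_starProjection_left_eq_right, negProj_eq_self w.2] at h
    have h1 : ⟪H (w : E), c • x⟫_ℂ = starRingEnd ℂ ⟪H (c • x), (w : E)⟫_ℂ := by
      rw [hs, inner_conj_symm]
    have h2 : RCLike.re ⟪H (c • x), (w : E)⟫_ℂ + RCLike.re ⟪T (c • y), (w : E)⟫_ℂ = 0 := by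
      rw [← map_add, ← inner_add_left, map_smul, map_smul, ← smul_add, inner_smul_left, h0,
        mul_zero, map_zero]
    have h3 : ∀ a : ℂ, RCLike.re (starRingEnd ℂ c * (c * a)) = ‖c‖ ^ 2 * RCLike.re a := by
      intro a
      rw [← mul_assoc, RCLike.conj_mul, ← RCLike.ofReal_pow, RCLike.re_ofReal_mul]
    have h4 : ⟪H (c • x), c • x⟫_ℂ = starRingEnd ℂ c * (c * ⟪H x, x⟫_ℂ) := by
      rw [map_smul, inner_smul_left, inner_smul_right]
    have h5 : ⟪T (c • y), c • x⟫_ℂ = starRingEnd ℂ c * (c * ⟪T y, x⟫_ℂ) := by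
      rw [map_smul, inner_smul_left, inner_smul_right]
    have h6 : ⟪D (c • y), c • y⟫_ℂ = starRingEnd ℂ c * (c * ⟪D y, y⟫_ℂ) := by
      rw [map_smul, inner_smul_left, inner_smul_right]
    simp only [blockForm, reApplyInnerSelf_apply]
    rw [map_add H, inner_add_left, inner_add_right, inner_add_right, inner_add_right, h1, h4, h5,
      h6]
    simp only [map_add, h3, RCLike.conj_re]
    linear_combination 2 * h2

theorem negProj_apply {H : E →L[ℂ] E} (hH : IsSelfAdjoint H) (x : E) :
    negProj H (H x) = -sqrtAbs H (sqrtAbs H (negProj H x)) := by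
  have h : negProj H (negProj H (sqrtAbs H (sqrtAbs H x))) =
      negProj H (sqrtAbs H (sqrtAbs H x)) :=
    negProj_eq_self (Submodule.starProjection_apply_mem _ _)
  rw [← signOp_sqrtAbs_sqrtAbs hH, signOp_apply, map_sub, map_nsmul, h, negProj_sqrtAbs hH,
    negProj_sqrtAbs hH, two_smul]
  abel

theorem negProj_mem (H : E →L[ℂ] E) (x : E) : negProj H x ∈ (nonnegSubspace H)ᗮ :=
  Submodule.starProjection_apply_mem _ _

theorem norm_negProj_le (H : E →L[ℂ] E) (x : E) : ‖negProj H x‖ ≤ ‖x‖ :=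
  Submodule.norm_starProjection_apply_le _ x

theorem negProj_eq_zero {H : E →L[ℂ] E} {x : E} (hx : x ∈ nonnegSubspace H) :
    negProj H x = 0 := by
  rw [negProj, Submodule.starProjection_orthogonal', _root_.sub_apply, one_apply_eq_self,
    Submodule.starProjection_eq_self_iff.2 hx, sub_self]

/-- `|H|^{1/2}` is an isomorphism of `E_H((-∞, 0))` when this subspace is finite-dimensional. -/
theorem exists_sqrtAbs_inverse {H : E →L[ℂ] E} (hH : IsSelfAdjoint H) (hfin : negIndex H < ⊤) :
    ∃ c : ℝ, 0 ≤ c ∧ ∀ u ∈ (nonnegSubspace H)ᗮ, ∃ x ∈ (nonnegSubspace H)ᗮ,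
      sqrtAbs H x = u ∧ ‖x‖ ≤ c * ‖u‖ := by
  have hfd : FiniteDimensional ℂ (nonnegSubspace H)ᗮ := by
    rw [negIndex_eq_rank hH, lt_top_iff_ne_top, Ne, Cardinal.toENat_eq_top, not_le] at hfin
    exact Module.rank_lt_aleph0_iff.1 hfin
  let s : (nonnegSubspace H)ᗮ →ₗ[ℂ] (nonnegSubspace H)ᗮ :=
    (sqrtAbs H).toLinearMap.restrict fun x hx => sqrtAbs_mem_orthogonal hH hx
  have hs : Function.Injective s := by
    rw [injective_iff_map_eq_zero]
    intro x hx
    exact Subtype.ext (eq_zero_of_mem_orthogonal hH x.2 (congrArg Subtype.val hx))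
  let e := LinearEquiv.ofInjectiveEndo s hs
  let g := LinearMap.toContinuousLinearMap e.symm.toLinearMap
  refine ⟨‖g‖, g.opNorm_nonneg, fun u hu => ⟨g ⟨u, hu⟩, (g ⟨u, hu⟩).2, ?_, g.le_opNorm ⟨u, hu⟩⟩⟩
  exact congrArg Subtype.val (e.apply_symm_apply ⟨u, hu⟩)

theorem norm_le_of_forall_quadratic {w : ℂ} {a m : ℝ} (ha : 0 ≤ a) (hm : 0 ≤ m)
    (h : ∀ t : ℝ, 0 ≤ (t * ‖w‖) ^ 2 * a ^ 2 + 2 * t * ‖w‖ ^ 2 + m ^ 2) : ‖w‖ ≤ a * m := by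
  have h1 := discrim_le_zero (a := ‖w‖ ^ 2 * a ^ 2) (b := 2 * ‖w‖ ^ 2) (c := m ^ 2)
    fun t => by linarith [h t]
  rw [discrim] at h1
  by_cases hw : ‖w‖ = 0
  · rw [hw]; positivity
  · have hw' : 0 < ‖w‖ ^ 2 := by positivity
    have h2 : ‖w‖ ^ 2 * (‖w‖ ^ 2) ≤ ‖w‖ ^ 2 * ((a * m) ^ 2) := by linarith
    exact abs_le_of_sq_le_sq' (le_of_mul_le_mul_left h2 hw') (by positivity) |>.2

/-- For `a • x` in the nonnegative subspace, a negative component `v` depending only on `y` makes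
`(a • x + v, y)` admissible in `blockForm_nonneg`. The resulting quadratic inequality in the scalar
bounds the cross term. -/
theorem exists_norm_inner_le {H : E →L[ℂ] E} (hH : IsSelfAdjoint H) (hfin : negIndex H < ⊤)
    {T : F →L[ℂ] E} {D : F →L[ℂ] F} (hle : formIndex (blockForm H T D) ≤ negIndex H) :
    ∃ C : ℝ, 0 ≤ C ∧ ∀ x ∈ nonnegSubspace H, ∀ y : F,
      ‖⟪T y, x⟫_ℂ‖ ≤ C * ‖sqrtAbs H x‖ * ‖y‖ := by
  obtain ⟨c, hc, hinv⟩ := exists_sqrtAbs_inverse hH hfin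
  refine ⟨Real.sqrt ((c * ‖T‖) ^ 2 + ‖D‖), Real.sqrt_nonneg _, fun x hx y => ?_⟩
  -- On the negative subspace `H = -S²`, so the required `v` solves `S²v = P(Ty)`; the intermediate
  -- `u = Sv` contributes `-‖u‖² + 2‖u‖² = ‖u‖²` to the form.
  obtain ⟨u, hu, hSu, hun⟩ := hinv _ (negProj_mem H (T y))
  obtain ⟨v, hv, hSv, -⟩ := hinv u hu
  have hun' : ‖u‖ ≤ c * ‖T‖ * ‖y‖ := by
    refine hun.trans ?_
    rw [mul_assoc]
    exact mul_le_mul_of_nonneg_left ((norm_negProj_le H _).trans (T.le_opNorm y)) hc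
  have hTv : ⟪T y, v⟫_ℂ = ⟪u, u⟫_ℂ := by
    rw [← negProj_eq_self hv, ← Submodule.inner_starProjection_left_eq_right]
    have : (nonnegSubspace H)ᗮ.starProjection (T y) = sqrtAbs H u := hSu.symm
    rw [this, sqrtAbs_inner, hSv]
  have hPx := negProj_eq_zero hx
  have hD : D.reApplyInnerSelf y ≤ ‖D‖ * ‖y‖ ^ 2 := by
    rw [reApplyInnerSelf_apply]
    calc _ ≤ ‖⟪D y, y⟫_ℂ‖ := RCLike.re_le_norm _
      _ ≤ ‖D y‖ * ‖y‖ := norm_inner_le_norm _ _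
      _ ≤ ‖D‖ * ‖y‖ * ‖y‖ := by gcongr; exact D.le_opNorm y
      _ = _ := by ring
  rw [mul_assoc, mul_left_comm]
  refine norm_le_of_forall_quadratic (norm_nonneg _) (by positivity) fun t => ?_
  set w := ⟪T y, x⟫_ℂ
  -- This phase makes the cross term the real number `t‖w‖²`.
  set a : ℂ := t * starRingEnd ℂ w
  have hcond : negProj H (H (a • x + v) + T y) = 0 := by
    rw [map_add, negProj_apply hH, map_add, map_smul, hPx, smul_zero, zero_add,
      negProj_eq_self hv, hSv, hSu, neg_add_cancel]
  have hq := blockForm_nonneg hH hfin hle hcond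
  have hS : sqrtAbs H (a • x + v) = a • sqrtAbs H x + u := by rw [map_add, map_smul, hSv]
  have hPS : negProj H (sqrtAbs H (a • x + v)) = u := by
    rw [negProj_sqrtAbs hH, map_add, map_smul, hPx, smul_zero, zero_add, negProj_eq_self hv, hSv]
  have horth : ⟪a • sqrtAbs H x, u⟫_ℂ = 0 :=
    Submodule.inner_right_of_mem_orthogonal
      ((nonnegSubspace H).smul_mem a (sqrtAbs_mem_nonnegSubspace hH hx)) hu
  have hpyth : ‖a • sqrtAbs H x + u‖ ^ 2 = ‖a • sqrtAbs H x‖ ^ 2 + ‖u‖ ^ 2 := by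
    rw [pow_two, pow_two, pow_two]
    exact norm_add_sq_eq_norm_sq_add_norm_sq_of_inner_eq_zero _ _ horth
  have ha : ‖a‖ = |t| * ‖w‖ := by simp [a]
  have haw : RCLike.re (a * w) = t * ‖w‖ ^ 2 := by
    simp only [a]
    rw [mul_assoc, RCLike.conj_mul, ← RCLike.ofReal_pow]
    exact RCLike.re_ofReal_mul t _ |>.trans (by rw [RCLike.ofReal_re])
  simp only [blockForm] at hq
  rw [reApplyInnerSelf_eq hH, hPS, hS, hpyth, inner_add_right, inner_smul_right, hTv, map_add,
    inner_self_eq_norm_sq, norm_smul, ha, mul_pow, mul_pow, sq_abs] at hq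
  have haw' : RCLike.re (a * ⟪T y, x⟫_ℂ) = t * ‖w‖ ^ 2 := haw
  rw [haw'] at hq
  have hu2 : ‖u‖ ^ 2 ≤ (c * ‖T‖ * ‖y‖) ^ 2 := by gcongr
  rw [mul_pow (Real.sqrt _), Real.sq_sqrt (by positivity)]
  nlinarith

variable [CompleteSpace F]

theorem IsFundamentalSymmetry.inner_apply_left {J : E →L[ℂ] E} (hJ : IsFundamentalSymmetry J) (x y : E) :
    ⟪J x, y⟫_ℂ = ⟪x, J y⟫_ℂ := by
  rw [← adjoint_inner_right, hJ.1]

theorem IsFundamentalSymmetry.apply_apply {J : E →L[ℂ] E} (hJ : IsFundamentalSymmetry J) (x : E) :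
    J (J x) = x :=
  congrArg (fun S : E →L[ℂ] E => S x) hJ.2

theorem reApplyInnerSelf_sub_adjoint_signOn {H : E →L[ℂ] E} (hH : IsSelfAdjoint H)
    (D : F →L[ℂ] F) (K : F →L[ℂ] cran H) (y : F) :
    (D - adjoint K ∘L signOn H hH ∘L K).reApplyInnerSelf y =
      D.reApplyInnerSelf y - RCLike.re ⟪signOp H (K y : E), (K y : E)⟫_ℂ := by
  rw [reApplyInnerSelf_apply, reApplyInnerSelf_apply, _root_.sub_apply, inner_sub_left, map_sub,
    coe_comp, Function.comp_apply, adjoint_inner_left]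
  rfl

/-- Completing the square: as `sign(H)` is a selfadjoint involution, the sign form at `Sx +
sign(H)k` has cross term `2 Re(Sx, k)` and last term `(sign(H)k, k)`. -/
theorem blockForm_eq_of_factorization {H : E →L[ℂ] E} (hH : IsSelfAdjoint H)
    {T : F →L[ℂ] E} (D : F →L[ℂ] F) {K : F →L[ℂ] cran H}
    (hT : T = sqrtAbs H ∘L (cran H).subtypeL ∘L K) (x : E) (y : F) :
    blockForm H T D (x, y) =
      (‖sqrtAbs H x + signOp H (K y : E)‖ ^ 2 -
        2 * ‖negProj H (sqrtAbs H x + signOp H (K y : E))‖ ^ 2) +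
      (D - adjoint K ∘L signOn H hH ∘L K).reApplyInnerSelf y := by
  have hJ := isFundamentalSymmetry_signOp H
  have hTy : T y = sqrtAbs H (K y : E) := by rw [hT]; rfl
  have hexp : ∀ u k : E, ⟪signOp H (u + signOp H k), u + signOp H k⟫_ℂ =
      ⟪signOp H u, u⟫_ℂ + ⟪u, k⟫_ℂ + ⟪k, u⟫_ℂ + ⟪signOp H k, k⟫_ℂ := by
    intro u k
    rw [map_add, hJ.apply_apply, inner_add_left, inner_add_right, inner_add_right,
      hJ.inner_apply_left u (signOp H k), hJ.apply_apply, ← hJ.inner_apply_left k k]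
    ring
  rw [← re_inner_signOp, reApplyInnerSelf_sub_adjoint_signOn, hexp, blockForm,
    reApplyInnerSelf_apply H, inner_apply_eq_signOp hH, hTy, sqrtAbs_inner]
  simp only [map_add]
  rw [inner_re_symm (𝕜 := ℂ) (sqrtAbs H x) (K y : E)]
  ring

theorem formIndex_blockForm_eq {H : E →L[ℂ] E} (hH : IsSelfAdjoint H)
    {T : F →L[ℂ] E} {D : F →L[ℂ] F} {K : F →L[ℂ] cran H}
    (hT : T = sqrtAbs H ∘L (cran H).subtypeL ∘L K) (hK : IsJContractive D (signOn H hH) K) :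
    formIndex (blockForm H T D) = negIndex H := by
  refine le_antisymm ?_ (negIndex_le_formIndex_blockForm hH T D)
  rw [negIndex_eq_rank hH]
  refine formIndex_le_rank ((nonnegSubspace H)ᗮ.orthogonalProjectionOnto ∘L
    (sqrtAbs H).coprod (signOp H ∘L (cran H).subtypeL ∘L K)).toLinearMap ?_
  rintro ⟨x, y⟩ hz
  have hz' : negProj H (sqrtAbs H x + signOp H (K y : E)) = 0 := congrArg Subtype.val hz
  rw [blockForm_eq_of_factorization hH D hT, hz']
  have h1 := hK.2 y
  have h2 := sq_nonneg ‖sqrtAbs H x + signOp H (K y : E)‖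
  rw [norm_zero]
  linarith

/-- Split `x`: the nonnegative component is controlled by `exists_norm_inner_le`, the negative one
by invertibility of `|H|^{1/2}` there. -/
theorem exists_norm_adjoint_le {H : E →L[ℂ] E} (hH : IsSelfAdjoint H) (hfin : negIndex H < ⊤)
    {T : F →L[ℂ] E} {D : F →L[ℂ] F} (hle : formIndex (blockForm H T D) ≤ negIndex H) :
    ∃ C : ℝ, ∀ x, ‖adjoint T x‖ ≤ C * ‖sqrtAbs H x‖ := by
  obtain ⟨C, hC, hb⟩ := exists_norm_inner_le hH hfin hle
  obtain ⟨c, hc, hinv⟩ := exists_sqrtAbs_inverse hH hfin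
  have hinj : ∀ v ∈ (nonnegSubspace H)ᗮ, ‖v‖ ≤ c * ‖sqrtAbs H v‖ := by
    intro v hv
    obtain ⟨v', hv', h1, h2⟩ := hinv _ (sqrtAbs_mem_orthogonal hH hv)
    have : v' - v = 0 := eq_zero_of_mem_orthogonal hH (Submodule.sub_mem _ hv' hv) (by
      rw [map_sub, h1, sub_self])
    rwa [sub_eq_zero.1 this] at h2
  refine ⟨C * 2 + ‖T‖ * c, fun x => ?_⟩
  have hSP : ‖sqrtAbs H (negProj H x)‖ ≤ ‖sqrtAbs H x‖ := by
    rw [← negProj_sqrtAbs hH]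
    exact norm_negProj_le H _
  have hSP' : ‖sqrtAbs H (x - negProj H x)‖ ≤ 2 * ‖sqrtAbs H x‖ := by
    rw [map_sub]
    linarith [norm_sub_le (sqrtAbs H x) (sqrtAbs H (negProj H x))]
  have key : ∀ y, ‖⟪T y, x⟫_ℂ‖ ≤ (C * 2 + ‖T‖ * c) * ‖sqrtAbs H x‖ * ‖y‖ := by
    intro y
    have h1 : ⟪T y, x⟫_ℂ = ⟪T y, x - negProj H x⟫_ℂ + ⟪T y, negProj H x⟫_ℂ := by
      rw [← inner_add_right, sub_add_cancel]
    rw [h1]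
    calc _ ≤ ‖⟪T y, x - negProj H x⟫_ℂ‖ + ‖⟪T y, negProj H x⟫_ℂ‖ := norm_add_le _ _
      _ ≤ C * (2 * ‖sqrtAbs H x‖) * ‖y‖ + (‖T‖ * ‖y‖) * (c * ‖sqrtAbs H x‖) := by
        gcongr
        · exact (hb _ (sub_negProj_mem H x) y).trans (by gcongr)
        · refine (norm_inner_le_norm _ _).trans ?_
          gcongr
          · exact T.le_opNorm y
          · exact (hinj _ (negProj_mem H x)).trans (by gcongr)
      _ = _ := by ring
  -- At `y = T*x` the left side is `‖T*x‖²`, and one factor cancels.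
  have h2 := key (adjoint T x)
  rw [← adjoint_inner_right, inner_self_eq_norm_sq_to_K, ← RCLike.ofReal_pow, RCLike.norm_ofReal,
    abs_of_nonneg (by positivity), pow_two] at h2
  by_cases h0 : ‖adjoint T x‖ = 0
  · rw [h0]
    have : 0 ≤ C * 2 + ‖T‖ * c := by positivity
    positivity
  · exact le_of_mul_le_mul_right h2 (by positivity)

/-- Douglas factorization: the norm bound lets `Sx ↦ T*x` extend by density to a bounded `L` on
`cran H`, and `K = L*`. -/
theorem exists_factorization {H : E →L[ℂ] E} (hH : IsSelfAdjoint H) (hfin : negIndex H < ⊤)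
    {T : F →L[ℂ] E} {D : F →L[ℂ] F} (hle : formIndex (blockForm H T D) ≤ negIndex H) :
    ∃ K : F →L[ℂ] cran H, T = sqrtAbs H ∘L (cran H).subtypeL ∘L K := by
  obtain ⟨C, hC⟩ := exists_norm_adjoint_le hH hfin hle
  let L : cran H →L[ℂ] F :=
    (adjoint T).toLinearMap.extendOfNorm (sqrtAbsToCran H hH).toLinearMap
  have hL : ∀ x, L (sqrtAbsToCran H hH x) = adjoint T x :=
    LinearMap.extendOfNorm_eq (denseRange_sqrtAbsToCran hH) ⟨C, hC⟩
  refine ⟨adjoint L, ?_⟩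
  ext y
  refine ext_inner_right ℂ fun x => ?_
  have h : ⟪(adjoint L y : E), sqrtAbs H x⟫_ℂ = ⟪adjoint L y, sqrtAbsToCran H hH x⟫_ℂ := rfl
  change _ = ⟪sqrtAbs H (adjoint L y : E), x⟫_ℂ
  rw [sqrtAbs_inner, h, adjoint_inner_left, hL, adjoint_inner_right]

theorem isJContractive_of_factorization {H : E →L[ℂ] E} (hH : IsSelfAdjoint H)
    (hfin : negIndex H < ⊤) {T : F →L[ℂ] E} {D : F →L[ℂ] F} (hD : IsSelfAdjoint D)
    (hle : formIndex (blockForm H T D) ≤ negIndex H) {K : F →L[ℂ] cran H}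
    (hT : T = sqrtAbs H ∘L (cran H).subtypeL ∘L K) : IsJContractive D (signOn H hH) K := by
  obtain ⟨c, -, hinv⟩ := exists_sqrtAbs_inverse hH hfin
  refine ⟨?_, fun y => ?_⟩
  · refine IsSelfAdjoint.isSymmetric (hD.sub ?_)
    rw [isSelfAdjoint_iff', adjoint_comp, adjoint_comp, adjoint_adjoint,
      (isFundamentalSymmetry_signOn H hH).1, comp_assoc]
  set δ := (D - adjoint K ∘L signOn H hH ∘L K).reApplyInnerSelf y with hδ
  set k : E := (K y : E) with hk
  have hTy : T y = sqrtAbs H k := by rw [hT]; rfl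
  have key : ∀ v, 0 ≤ (2 * ‖sqrtAbs H v + k‖) ^ 2 + δ := by
    intro v
    -- With `Sm = Pk`, replacing the negative component of `v` by `m` cancels that of `sign(H)k`.
    -- Only `(1 - P)(Sv + k)` remains in the square; the factor 2 is a crude bound for `1 - P`.
    obtain ⟨m, hm, hSm, -⟩ := hinv _ (negProj_mem H k)
    have hPx : negProj H (v - negProj H v + m) = m := by
      rw [map_add, negProj_eq_zero (sub_negProj_mem H v), zero_add, negProj_eq_self hm]
    have hcond : negProj H (H (v - negProj H v + m) + T y) = 0 := by
      rw [map_add, negProj_apply hH, hPx, hSm, hTy, negProj_sqrtAbs hH, neg_add_cancel]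
    have hq := blockForm_nonneg hH hfin hle hcond
    have hz : sqrtAbs H (v - negProj H v + m) + signOp H k =
        (sqrtAbs H v + k) - negProj H (sqrtAbs H v + k) := by
      rw [map_add, map_sub, hSm, signOp_apply, map_add, negProj_sqrtAbs hH, two_smul]
      abel
    rw [blockForm_eq_of_factorization hH D hT, hz] at hq
    have h1 := norm_sub_le (sqrtAbs H v + k) (negProj H (sqrtAbs H v + k))
    have h2 := norm_negProj_le H (sqrtAbs H v + k)
    have h3 : ‖(sqrtAbs H v + k) - negProj H (sqrtAbs H v + k)‖ ^ 2 ≤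
        (2 * ‖sqrtAbs H v + k‖) ^ 2 := by
      gcongr
      linarith
    have h4 := sq_nonneg ‖negProj H ((sqrtAbs H v + k) - negProj H (sqrtAbs H v + k))‖
    linarith
  have hclosed : IsClosed {u : E | 0 ≤ (2 * ‖u + k‖) ^ 2 + δ} :=
    isClosed_le continuous_const (by fun_prop)
  -- Since `-k` lies in the closure of `ran S`, the inequality passes to the limit `Sv → -k`, where
  -- the square vanishes.
  have hmem := closure_minimal (s := Set.range (sqrtAbs H)) (by rintro _ ⟨v, rfl⟩; exact key v)
    hclosed (cran_le_closure_range_sqrtAbs hH ((cran H).neg_mem (K y).2))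
  simpa [hk] using hmem

theorem IsFundamentalSymmetry.isSelfAdjoint {J : E →L[ℂ] E} (hJ : IsFundamentalSymmetry J) :
    IsSelfAdjoint J :=
  hJ.1

/-- Completing the square in `y`, possible because the off-diagonal entry factors through `D`. -/
theorem blockForm_shear (H : E →L[ℂ] E) (B : E →L[ℂ] F) {D : F →L[ℂ] F} (hD : IsSelfAdjoint D)
    (x : E) (y : F) :
    blockForm H (adjoint B ∘L D) D (x, y) =
      (H - adjoint B ∘L D ∘L B).reApplyInnerSelf x + D.reApplyInnerSelf (B x + y) := by
  have hs : ⟪D (B x), y⟫_ℂ = starRingEnd ℂ ⟪D y, B x⟫_ℂ := by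
    rw [inner_conj_symm, ← adjoint_inner_right, show adjoint D = D from hD.star_eq]
  simp only [blockForm, reApplyInnerSelf_apply, _root_.sub_apply, coe_comp, Function.comp_apply,
    inner_sub_left, adjoint_inner_left, map_add, inner_add_left, inner_add_right, map_sub, hs,
    RCLike.conj_re]
  ring

/-- The number of negative squares of a block operator with a Schur complement. -/
theorem formIndex_blockForm_eq_add (H : E →L[ℂ] E) (B : E →L[ℂ] F) {D : F →L[ℂ] F}
    (hD : IsSelfAdjoint D) (hfin : negIndex D < ⊤) :
    formIndex (blockForm H (adjoint B ∘L D) D) =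
      negIndex (H - adjoint B ∘L D ∘L B) + negIndex D := by
  apply le_antisymm
  · rw [negIndex_eq_rank hD]
    refine formIndex_le_add (q' := (H - adjoint B ∘L D ∘L B).reApplyInnerSelf)
      (by simp [reApplyInnerSelf_apply])
      ((nonnegSubspace D)ᗮ.orthogonalProjectionOnto ∘L
        B.coprod (ContinuousLinearMap.id ℂ F)).toLinearMap
      (LinearMap.fst ℂ E F) ?_
    rintro ⟨x, y⟩ hz hq
    have h1 : 0 ≤ D.reApplyInnerSelf (B x + y) :=
      reApplyInnerSelf_nonneg hD (congrArg Subtype.val hz)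
    rw [blockForm_shear H B hD] at hq
    change (H - adjoint B ∘L D ∘L B).reApplyInnerSelf x < 0
    linarith
  · have key : ∀ L : Submodule ℂ E,
        (∀ x ∈ L, x ≠ 0 → (H - adjoint B ∘L D ∘L B).reApplyInnerSelf x < 0) →
        Cardinal.toENat (Module.rank ℂ L) + negIndex D ≤
          formIndex (blockForm H (adjoint B ∘L D) D) := by
      intro L hL
      -- The inverse shear `(l, u) ↦ (l, u - Bl)` carries a product of negative subspaces to one for
      -- the block form.
      have h1 := toENat_rank_le_formIndex (W := L × (nonnegSubspace D)ᗮ)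
        (blockForm_zero H (adjoint B ∘L D) D)
        (LinearMap.prod (L.subtype ∘ₗ LinearMap.fst ℂ _ _)
          ((nonnegSubspace D)ᗮ.subtype ∘ₗ LinearMap.snd ℂ _ _ -
            B.toLinearMap ∘ₗ L.subtype ∘ₗ LinearMap.fst ℂ _ _)) fun w hw => by
          obtain ⟨l, u⟩ := w
          change blockForm H (adjoint B ∘L D) D ((l : E), (u : F) - B l) < 0
          rw [blockForm_shear H B hD, add_sub_cancel]
          have hl : l ≠ 0 → (H - adjoint B ∘L D ∘L B).reApplyInnerSelf l < 0 :=
            fun h => hL l l.2 fun h' => h (Subtype.ext h')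
          have hu : u ≠ 0 → D.reApplyInnerSelf u < 0 :=
            fun h => reApplyInnerSelf_neg hD u.2 fun h' => h (Subtype.ext h')
          by_cases hl0 : l = 0
          · have hu0 : u ≠ 0 := fun h => hw (by rw [hl0, h]; rfl)
            have := hu hu0
            simpa [hl0, reApplyInnerSelf_apply] using this
          · by_cases hu0 : u = 0
            · simpa [hu0, reApplyInnerSelf_apply] using hl hl0
            · exact add_neg (hl hl0) (hu hu0)
      rwa [rank_prod, map_add, Cardinal.toENat_lift, Cardinal.toENat_lift,
        ← negIndex_eq_rank hD] at h1
    have h1 : negIndex D ≤ formIndex (blockForm H (adjoint B ∘L D) D) := by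
      have := key ⊥ fun x hx h => absurd ((Submodule.mem_bot ℂ).1 hx) h
      exact le_trans le_add_self this
    -- Moving the finite index of `D` across by subtraction allows the supremum over `L` to be
    -- taken; `L = ⊥` guards against truncation.
    exact add_le_of_le_tsub_right_of_le h1
      (iSup₂_le fun L hL => ENat.le_sub_of_add_le_right hfin.ne (key L hL))

end Block

end Krein

/-! ### From Kreĭn space adjoints to block operators -/

namespace Krein

open ContinuousLinearMap

variable {E F : Type*} [NormedAddCommGroup E] [InnerProductSpace ℂ E] [CompleteSpace E]
  [NormedAddCommGroup F] [InnerProductSpace ℂ F] [CompleteSpace F]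

theorem sqrtAbs_comp {J : E →L[ℂ] E} (hJ : IsFundamentalSymmetry J) (A : E →L[ℂ] E) :
    sqrtAbs (J ∘L A) = sqrtAbs A := by
  have h : star (J ∘L A) * (J ∘L A) = star A * A := by
    change adjoint (J ∘L A) ∘L (J ∘L A) = adjoint A ∘L A
    rw [adjoint_comp, hJ.1, comp_assoc, ← comp_assoc J J A, hJ.2, id_comp]
  rw [sqrtAbs, sqrtAbs, CFC.abs, CFC.abs, h]

theorem comp_kadjoint {J₁ : E →L[ℂ] E} (hJ₁ : IsFundamentalSymmetry J₁) (J₂ : F →L[ℂ] F)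
    (B : E →L[ℂ] F) : J₁ ∘L kadjoint J₁ J₂ B = adjoint B ∘L J₂ := by
  rw [kadjoint, ← comp_assoc, hJ₁.2, id_comp]

theorem kreinNegIndex_sub_kadjoint {J₁ : E →L[ℂ] E} (hJ₁ : IsFundamentalSymmetry J₁)
    (J₂ : F →L[ℂ] F) (A : E →L[ℂ] E) (B : E →L[ℂ] F) :
    kreinNegIndex J₁ (A - kadjoint J₁ J₂ B ∘L B) =
      negIndex (J₁ ∘L A - adjoint B ∘L J₂ ∘L B) := by
  rw [kreinNegIndex, comp_sub, ← comp_assoc, comp_kadjoint hJ₁, comp_assoc]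

end Krein

theorem theorem3p1 {H₁ H₂ : Type*}
    [NormedAddCommGroup H₁] [InnerProductSpace ℂ H₁] [CompleteSpace H₁]
    [NormedAddCommGroup H₂] [InnerProductSpace ℂ H₂] [CompleteSpace H₂]
    (J₁ : H₁ →L[ℂ] H₁) (J₂ : H₂ →L[ℂ] H₂)
    (hJ₁ : Krein.IsFundamentalSymmetry J₁) (hJ₂ : Krein.IsFundamentalSymmetry J₂)
    (A : H₁ →L[ℂ] H₁) (hA : Krein.IsKreinSelfAdjoint J₁ A) (B : H₁ →L[ℂ] H₂)
    (hνA : Krein.kreinNegIndex J₁ A < ⊤) (hνJ₂ : Krein.negIndex J₂ < ⊤) :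
    (Krein.kreinNegIndex J₁ A =
        Krein.kreinNegIndex J₁ (A - Krein.kadjoint J₁ J₂ B ∘L B) + Krein.negIndex J₂ →
      LinearMap.range (J₁ ∘L Krein.kadjoint J₁ J₂ B).toLinearMap ≤
          LinearMap.range (Krein.sqrtAbs A).toLinearMap ∧
        ∃ K : H₂ →L[ℂ] Krein.cran (J₁ ∘L A),
          J₁ ∘L Krein.kadjoint J₁ J₂ B =
              Krein.sqrtAbs A ∘L (Krein.cran (J₁ ∘L A)).subtypeL ∘L K ∧
            Krein.IsJContractive J₂ (Krein.signOn (J₁ ∘L A) (hA.isSelfAdjoint hJ₁)) K ∧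
            ∀ K' : H₂ →L[ℂ] Krein.cran (J₁ ∘L A),
              J₁ ∘L Krein.kadjoint J₁ J₂ B =
                  Krein.sqrtAbs A ∘L (Krein.cran (J₁ ∘L A)).subtypeL ∘L K' →
                K' = K) ∧
    ((∃ K : H₂ →L[ℂ] Krein.cran (J₁ ∘L A),
        J₁ ∘L Krein.kadjoint J₁ J₂ B =
            Krein.sqrtAbs A ∘L (Krein.cran (J₁ ∘L A)).subtypeL ∘L K ∧
          Krein.IsJContractive J₂ (Krein.signOn (J₁ ∘L A) (hA.isSelfAdjoint hJ₁)) K) →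
      Krein.kreinNegIndex J₁ A =
        Krein.kreinNegIndex J₁ (A - Krein.kadjoint J₁ J₂ B ∘L B) + Krein.negIndex J₂) := by
  have hH := hA.isSelfAdjoint hJ₁
  -- Since `J₁` is unitary, `|J₁A| = |A|`. Condition (1) becomes equality of the index of `J₁A` with
  -- that of the block form.
  rw [Krein.kreinNegIndex_sub_kadjoint hJ₁, Krein.comp_kadjoint hJ₁, ← Krein.sqrtAbs_comp hJ₁ A,
    ← Krein.formIndex_blockForm_eq_add (J₁ ∘L A) B hJ₂.isSelfAdjoint hνJ₂]
  constructor
  · intro heq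
    obtain ⟨K, hK⟩ := Krein.exists_factorization hH hνA heq.ge
    refine ⟨?_, K, hK, Krein.isJContractive_of_factorization hH hνA hJ₂.isSelfAdjoint heq.ge hK,
      fun K' hK' => Krein.factorization_unique hH (hK'.symm.trans hK)⟩
    rintro _ ⟨y, rfl⟩
    exact ⟨K y, congrArg (fun S : H₂ →L[ℂ] H₁ => S y) hK.symm⟩
  · rintro ⟨K, hK, hcontr⟩
    exact (Krein.formIndex_blockForm_eq hH hK hcontr).symm
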